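/- Let $n$ be a nonnegative integer and let $V$ be a $2n$-dimensional complex vector space with a nondegenerate alternating bilinear form $\langle\cdot,\cdot\rangle$. For $x\in\operatorname{End}(V)$ let $x^\perp$ be its adjoint, $\langle xa,b\rangle=\langle a,x^\perp b\rangle$; let $\mathcal N\subset\operatorname{End}(V)$ be the set of nilpotent endomorphisms and $S=\{y\in\operatorname{End}(V): y=y^\perp\}$. For $v,u\in V$ put $\tau_{v,u}(v')=\langle u,v'\rangle v$, and let $$Z=\{(v,u,x)\in V\times V\times\mathcal N : x^\perp-x=\tau_{v,u}+\tau_{u,v}\}.$$ A bipartition $(\mu;\nu)$ of $m$ is a pair of partitions (weakly decreasing, eventually zero sequences of nonnegative integers) with $|\mu|+|\nu|=m$; let $\mathcal Q_m$ be the set of them, and $$\mathcal Q'_{2n}=\{(\mu;\nu)\in\mathcal Q_{2n} : \mu_1-\mu_2+\mu_3-\cdots=\nu_1-\nu_2+\nu_3-\cdots\}.$$ For $(\mu;\nu)\in\mathcal Q_{2n}$ let $\mathcal O_{\mu;\nu}\subset V\times\mathcal N$ be the orbit in the enhanced nilpotent cone consisting of the pairs $(v,x)$ such that $x$ has Jordan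 type $(\mu_1+\nu_1,\mu_2+\nu_2,\ldots)$ and the endomorphism of $V/\mathbb C[x]v$ induced by $x$ has Jordan type $(\mu_2+\nu_1,\mu_3+\nu_2,\ldots)$. For $(\mu;\nu)\in\mathcal Q_n$ let $\mathbb O_{\mu;\nu}=(V\times(\mathcal N\cap S))\cap\mathcal O_{\mu\cup\mu;\nu\cup\nu}$ be the corresponding orbit in the exotic nilpotent cone, where $\mu\cup\mu=(\mu_1,\mu_1,\mu_2,\mu_2,\ldots)$. Let $(v,u,x)\in Z$. Then $(v,x)\in\mathcal O_{\mu;\nu}$ for some $(\mu;\nu)\in\mathcal Q'_{2n}$. Moreover, for every $(\mu;\nu)\in\mathcal Q_{2n}$ with $(v,x)\in\mathcal O_{\mu;\nu}$ we have $(\mu;\nu)\in\mathcal Q'_{2n}$, and $(v,x+\tau_{v,u})\in\mathbb O_{\widetilde\mu;\widetilde\nu}$, where $(\widetilde\mu;\widetilde\nu)\in\mathcal Q_n$ is given, for all $k\ge 1$, by $$\widetilde\mu_k=\sum_{i=1}^{2k-1}(-1)^{i-1}\mu_i-\sum_{i=1}^{2k-2}(-1)^{i-1}\nu_i,\qquad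 \widetilde\nu_k=\sum_{i=1}^{2k-1}(-1)^{i-1}\nu_i-\sum_{i=1}^{2k}(-1)^{i-1}\mu_i .$$ (In particular these formulas define a bipartition of $n$.) -/

import Mathlib

namespace ExoticRS

noncomputable section

/-- A partition: a weakly decreasing, eventually zero sequence of nonnegative integers.
Indexing starts at `0`, so `lam.part i` is the part usually written `λ_{i+1}`. -/
@[ext]
structure Ptn where
  part : ℕ → ℕ
  antitone_part : Antitone part
  finite_support : part.support.Finite

/-- The size `|λ| = λ₁ + λ₂ + ⋯`. -/
def Ptn.size (lam : Ptn) : ℕ := ∑ᶠ i, lam.part i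

/-- The alternating sum `λ₁ - λ₂ + λ₃ - λ₄ + ⋯`. -/
def Ptn.altSum (lam : Ptn) : ℤ := ∑ᶠ i, (-1 : ℤ) ^ i * (lam.part i : ℤ)

/-- The alternating sum of the first `k` parts, `λ₁ - λ₂ + ⋯ ± λ_k`. -/
def Ptn.partialAltSum (lam : Ptn) (k : ℕ) : ℤ :=
  ∑ i ∈ Finset.range k, (-1 : ℤ) ^ i * (lam.part i : ℤ)

/-- The partition `μ + ν = (μ₁ + ν₁, μ₂ + ν₂, …)`. -/
def Ptn.add (mu nu : Ptn) : Ptn where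
  part i := mu.part i + nu.part i
  antitone_part := fun _ _ h => Nat.add_le_add (mu.antitone_part h) (nu.antitone_part h)
  finite_support := (mu.finite_support.union nu.finite_support).subset
    (Function.support_add mu.part nu.part)

/-- The partition `(λ₂, λ₃, …)`. -/
def Ptn.tail (lam : Ptn) : Ptn where
  part i := lam.part (i + 1)
  antitone_part := fun _ _ h => lam.antitone_part (Nat.add_le_add_right h 1)
  finite_support := lam.finite_support.subset fun i hi => by
    have h := lam.antitone_part (Nat.le_succ i)
    simp only [Function.mem_support] at hi ⊢
    simp only [Nat.succ_eq_add_one] at h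
    omega

/-- The duplex partition `λ ∪ λ = (λ₁, λ₁, λ₂, λ₂, …)`. -/
def Ptn.dup (lam : Ptn) : Ptn where
  part i := lam.part (i / 2)
  antitone_part := fun _ _ h => lam.antitone_part (Nat.div_le_div_right h)
  finite_support := by
    obtain ⟨N, hN⟩ := lam.finite_support.bddAbove
    refine (Set.finite_Iic (2 * N + 1)).subset fun i hi => ?_
    have h : i / 2 ≤ N := hN hi
    simp only [Set.mem_Iic]
    omega

/-- The set `Q_m` of bipartitions `(μ;ν)` of `m`. -/
def bipartitions (m : ℕ) : Set (Ptn × Ptn) :=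
  {p | p.1.size + p.2.size = m}

/-- The set `Q'_m` of bipartitions `(μ;ν)` of `m` such that
`μ₁ - μ₂ + μ₃ - ⋯ = ν₁ - ν₂ + ν₃ - ⋯`. -/
def balancedBipartitions (m : ℕ) : Set (Ptn × Ptn) :=
  {p | p ∈ bipartitions m ∧ p.1.altSum = p.2.altSum}

variable {V : Type*} [AddCommGroup V] [Module ℂ V]

/-- The nilpotent endomorphism `x` has Jordan type `lam`: there is a basis made of
strings `b i 0, …, b i (λ_i - 1)` such that `x` sends `b i (j + 1)` to `b i j` and
kills `b i 0`. -/
def HasJordanType (x : Module.End ℂ V) (lam : Ptn) : Prop :=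
  ∃ b : Module.Basis (Σ i : ℕ, Fin (lam.part i)) ℂ V,
    (∀ (i : ℕ) (h : 0 < lam.part i), x (b ⟨i, ⟨0, h⟩⟩) = 0) ∧
    ∀ (i j : ℕ) (h : j + 1 < lam.part i),
      x (b ⟨i, ⟨j + 1, h⟩⟩) = b ⟨i, ⟨j, Nat.lt_of_succ_lt h⟩⟩

/-- The subspace `ℂ[x]v`, spanned by `v, x v, x² v, …`. -/
def cyclicSubspace (x : Module.End ℂ V) (v : V) : Submodule ℂ V :=
  Submodule.span ℂ (Set.range fun i : ℕ => (x ^ i) v)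

theorem cyclicSubspace_le_comap (x : Module.End ℂ V) (v : V) :
    cyclicSubspace x v ≤ (cyclicSubspace x v).comap x := by
  refine Submodule.span_le.2 ?_
  rintro _ ⟨i, rfl⟩
  refine Submodule.subset_span ⟨i + 1, ?_⟩
  simp [pow_succ']

/-- The endomorphism of `V / ℂ[x]v` induced by `x`. -/
def inducedQuotient (x : Module.End ℂ V) (v : V) :
    Module.End ℂ (V ⧸ cyclicSubspace x v) :=
  (cyclicSubspace x v).mapQ (cyclicSubspace x v) x (cyclicSubspace_le_comap x v)

/-- The orbit `O_{μ;ν}` in the enhanced nilpotent cone `V × N`: the pairs `(v, x)` with `x`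
nilpotent of Jordan type `μ + ν = (μ₁ + ν₁, μ₂ + ν₂, …)` whose induced endomorphism of
`V / ℂ[x]v` has Jordan type `(μ₂ + ν₁, μ₃ + ν₂, …)`. -/
def enhancedOrbit (V : Type*) [AddCommGroup V] [Module ℂ V] (mu nu : Ptn) :
    Set (V × Module.End ℂ V) :=
  {p | IsNilpotent p.2 ∧ HasJordanType p.2 (mu.add nu) ∧
    HasJordanType (inducedQuotient p.2 p.1) (mu.tail.add nu)}

/-- The rank-one endomorphism `τ_{v,u} : v' ↦ ⟨u, v'⟩ v`. -/
def tau (ω : LinearMap.BilinForm ℂ V) (v u : V) : Module.End ℂ V :=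
  (ω u).smulRight v

variable [FiniteDimensional ℂ V]

/-- The adjoint `x^⊥` of `x` for a nondegenerate form `ω`: the unique endomorphism with
`⟨x a, b⟩ = ⟨a, x^⊥ b⟩` (see `adjoint_apply`, `eq_adjoint`). -/
def adjoint (ω : LinearMap.BilinForm ℂ V) (hω : ω.Nondegenerate) (x : Module.End ℂ V) :
    Module.End ℂ V :=
  LinearMap.BilinForm.leftAdjointOfNondegenerate ω.flip hω.flip x

theorem adjoint_apply (ω : LinearMap.BilinForm ℂ V) (hω : ω.Nondegenerate)
    (x : Module.End ℂ V) (a b : V) : ω (x a) b = ω a (adjoint ω hω x b) :=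
  (LinearMap.BilinForm.isAdjointPairLeftAdjointOfNondegenerate ω.flip hω.flip x b a).symm

theorem eq_adjoint (ω : LinearMap.BilinForm ℂ V) (hω : ω.Nondegenerate)
    (x y : Module.End ℂ V) (h : ∀ a b, ω (x a) b = ω a (y b)) : y = adjoint ω hω x := by
  ext b
  refine sub_eq_zero.1 (hω.2 _ fun a => ?_)
  rw [map_sub, ← h, ← adjoint_apply, sub_self]

/-- The exotic nilpotent cone `V × (N ∩ S)`, where `S` is the space of
endomorphisms `y` with `y = y^⊥`. -/
def exoticNilpotentCone (ω : LinearMap.BilinForm ℂ V) (hω : ω.Nondegenerate) :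
    Set (V × Module.End ℂ V) :=
  {p | IsNilpotent p.2 ∧ p.2 = adjoint ω hω p.2}

/-- The exotic orbit of `(μ;ν)`: the intersection of the exotic nilpotent cone with the
enhanced orbit `O_{μ∪μ;ν∪ν}`. -/
def exoticOrbit (ω : LinearMap.BilinForm ℂ V) (hω : ω.Nondegenerate) (mu nu : Ptn) :
    Set (V × Module.End ℂ V) :=
  exoticNilpotentCone ω hω ∩ enhancedOrbit V mu.dup nu.dup

/-- The variety `Z` of triples `(v, u, x)`, with `x` nilpotent and
`x^⊥ - x = τ_{v,u} + τ_{u,v}`. -/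
def Z (ω : LinearMap.BilinForm ℂ V) (hω : ω.Nondegenerate) :
    Set (V × V × Module.End ℂ V) :=
  {t | IsNilpotent t.2.2 ∧ adjoint ω hω t.2.2 - t.2.2 = tau ω t.1 t.2.1 + tau ω t.2.1 t.1}

end

end ExoticRS

/-! ### Existence of Jordan types. -/

namespace ExoticRS

/-! Put `y = x + tau ω v u`. The adjoint of `τ_{v,u}` is `-τ_{u,v}`, so the equation defining `Z`
says exactly that `y` is self-adjoint. For self-adjoint `s` the form `⟨s a, b⟩` is alternating,
hence `s` has even rank. This has two uses. In `isNilpotent_add_tau`, every eigenspace of `y` has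
dimension at least 2, so it meets the hyperplane (or whole space) `⟨u, ·⟩ = 0`, on which `y = x`;
thus 0 is the only eigenvalue of `y`. In `HasJordanType.part_two_mul`, all powers of `y` have even
rank, so the Jordan blocks of `y` come in equal pairs.

Since `y - x` takes values in `ℂ v`, the maps `x` and `y` have the same cyclic subspace at `v` and
induce the same map on the quotient. Let `(mu; nu)` and the duplex pair built from `(mu'; nu')` be
the bipartitions of `(v, x)` and `(v, y)`. They share the dimension `μ₁` of the cyclic subspace and
the quotient type `(μ₂ + ν₁, μ₃ + ν₂, …)`. These data determine `mu'` and `nu'` recursively from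
`mu` and `nu`, which yields the alternating sums (`duplex_part_formula`); far out `nu'` vanishes,
which forces the balance condition.

Bipartitions exist because the Jordan types of a nilpotent map and of its quotient by a cyclic
subspace interlace (`interlace`, `exists_bipartition_of_interlace`). -/

open Polynomial in
/-- The cyclic module `ℂ[X] / (X ^ k)` has a basis forming a single string of length `k` for
multiplication by `X`. -/
theorem exists_string_basis_quotient_X_pow (k : ℕ) :
    ∃ b : Module.Basis (Fin k) ℂ (ℂ[X] ⧸ Submodule.span ℂ[X] {(X : ℂ[X]) ^ k}),
      (∀ h : 0 < k, (X : ℂ[X]) • b ⟨0, h⟩ = 0) ∧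
      ∀ (j : ℕ) (h : j + 1 < k), (X : ℂ[X]) • b ⟨j + 1, h⟩ = b ⟨j, Nat.lt_of_succ_lt h⟩ := by
  have hm : (X ^ k : ℂ[X]).Monic := monic_X_pow k
  -- `AdjoinRoot` is definitionally this quotient, so its power basis can be used. It is reversed
  -- below because multiplication by `X` must lower the index.
  let e : AdjoinRoot (X ^ k : ℂ[X]) ≃ₗ[ℂ] (ℂ[X] ⧸ Submodule.span ℂ[X] {(X : ℂ[X]) ^ k}) :=
    LinearEquiv.refl _ _
  have hdeg : (X ^ k : ℂ[X]).natDegree = k := natDegree_X_pow k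
  let b := (((AdjoinRoot.powerBasis' hm).basis.reindex (finCongr hdeg)).reindex
    Fin.revPerm).map e
  have hb : ∀ j : Fin k, b j = Submodule.Quotient.mk (X ^ (k - 1 - (j : ℕ))) := by
    intro j
    have : b j = e ((AdjoinRoot.root (X ^ k : ℂ[X])) ^ (k - 1 - (j : ℕ))) := by
      simp only [b, Module.Basis.map_apply, Module.Basis.reindex_apply, PowerBasis.coe_basis]
      congr 2
      change k - ((j : ℕ) + 1) = _
      omega
    rw [this, ← AdjoinRoot.mk_X, ← map_pow]
    rfl
  refine ⟨b, fun h => ?_, fun j h => ?_⟩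
  · rw [hb, ← Submodule.Quotient.mk_smul, Submodule.Quotient.mk_eq_zero, smul_eq_mul,
      ← pow_succ']
    have : k - 1 - 0 + 1 = k := by omega
    simp only [this]
    exact Submodule.mem_span_singleton_self _
  · rw [hb, hb, ← Submodule.Quotient.mk_smul, smul_eq_mul, ← pow_succ']
    congr 2
    simp only
    omega

variable {V : Type*} [AddCommGroup V] [Module ℂ V]

-- `X` acts on `V` as `x`, so `V` is an `X`-power torsion `ℂ[X]`-module, and the structure theorem
-- splits it into cyclic modules `ℂ[X] / (X ^ k i)`.
open Polynomial in
theorem exists_string_basis [FiniteDimensional ℂ V] (x : Module.End ℂ V) (hx : IsNilpotent x) :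
    ∃ (d : ℕ) (k : Fin d → ℕ) (b : Module.Basis (Σ i : Fin d, Fin (k i)) ℂ V),
      (∀ (i : Fin d) (h : 0 < k i), x (b ⟨i, ⟨0, h⟩⟩) = 0) ∧
      ∀ (i : Fin d) (j : ℕ) (h : j + 1 < k i),
        x (b ⟨i, ⟨j + 1, h⟩⟩) = b ⟨i, ⟨j, Nat.lt_of_succ_lt h⟩⟩ := by
  classical
  obtain ⟨N, hN⟩ := hx
  have hT : Module.IsTorsion' (Module.AEval' x) (Submonoid.powers (X : ℂ[X])) := by
    intro m
    refine ⟨⟨X ^ N, N, rfl⟩, ?_⟩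
    obtain ⟨w, rfl⟩ := (Module.AEval'.of x).surjective m
    change (X ^ N : ℂ[X]) • Module.AEval'.of x w = 0
    rw [Module.AEval'.X_pow_smul_of, hN]
    simp
  obtain ⟨d, k, ⟨e⟩⟩ := Module.torsion_by_prime_power_decomposition
    (irreducible_X (R := ℂ)) hT
  choose c hc0 hc1 using fun i => exists_string_basis_quotient_X_pow (k i)
  let E : V ≃ₗ[ℂ] ∀ i, ℂ[X] ⧸ Submodule.span ℂ[X] {(X : ℂ[X]) ^ k i} :=
    (Module.AEval'.of x).trans
      ((e.restrictScalars ℂ).trans ((DirectSum.linearEquivFunOnFintype ℂ[X] (Fin d) _).restrictScalars ℂ))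
  have hE : ∀ w, E (x w) = (X : ℂ[X]) • E w := by
    intro w
    simp only [E, LinearEquiv.trans_apply, LinearEquiv.restrictScalars_apply,
      ← Module.AEval'.X_smul_of, map_smul]
  have hE' : ∀ w, x (E.symm w) = E.symm ((X : ℂ[X]) • w) := by
    intro w
    apply E.injective
    rw [hE]
    simp
  refine ⟨d, k, (Pi.basis c).map E.symm, fun i h => ?_, fun i j h => ?_⟩
  · rw [Module.Basis.map_apply, hE', Pi.basis_apply, ← Pi.single_smul, hc0]
    simp
  · rw [Module.Basis.map_apply, Module.Basis.map_apply, hE', Pi.basis_apply, Pi.basis_apply,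
      ← Pi.single_smul, hc1]

/-- Every nilpotent endomorphism has a Jordan type. -/
theorem exists_hasJordanType [FiniteDimensional ℂ V] (x : Module.End ℂ V)
    (hx : IsNilpotent x) : ∃ lam : Ptn, HasJordanType x lam := by
  obtain ⟨d, k, b, h0, h1⟩ := exists_string_basis x hx
  let s : Equiv.Perm (Fin d) := Tuple.sort (OrderDual.toDual ∘ k)
  have hs : ∀ i j, i ≤ j → k (s j) ≤ k (s i) :=
    fun i j hij => Tuple.monotone_sort (OrderDual.toDual ∘ k) hij
  let lam : Ptn :=
    { part := fun i => if h : i < d then k (s ⟨i, h⟩) else 0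
      antitone_part := by
        intro i j hij
        by_cases hj : j < d
        · have hi : i < d := hij.trans_lt hj
          simp only [hi, hj, dif_pos]
          exact hs _ _ hij
        · simp [hj]
      finite_support := (Set.finite_Iio d).subset fun i hi => by
        by_contra h
        simp only [Set.mem_Iio] at h
        simp [h] at hi }
  have hlt : ∀ i, 0 < lam.part i → i < d := by
    intro i hi
    by_contra h
    simp [lam, h] at hi
  have hk : ∀ (i : ℕ) (h : i < d), lam.part i = k (s ⟨i, h⟩) := fun i h => dif_pos h
  let e : (Σ i : Fin d, Fin (k (s i))) ≃ Σ i : ℕ, Fin (lam.part i) :=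
    { toFun := fun p => ⟨p.1, ⟨p.2, by rw [hk _ p.1.2]; exact p.2.2⟩⟩
      invFun := fun p => ⟨⟨p.1, hlt _ (p.2.pos)⟩,
        ⟨p.2, by rw [← hk _ (hlt _ (p.2.pos))]; exact p.2.2⟩⟩
      left_inv := fun _ => rfl
      right_inv := fun _ => rfl }
  let B := (b.reindex (Equiv.sigmaCongrLeft s).symm).reindex e
  have hB : ∀ (i j : ℕ) (h : j < lam.part i),
      B ⟨i, ⟨j, h⟩⟩ = b ⟨s ⟨i, hlt i (Nat.zero_lt_of_lt h)⟩,
        ⟨j, by rw [← hk]; exact h⟩⟩ := by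
    intro i j h
    simp only [B, Module.Basis.reindex_apply]
    rfl
  refine ⟨lam, B, fun i h => ?_, fun i j h => ?_⟩
  · rw [hB, h0]
  · rw [hB, hB, h1]

end ExoticRS

/-! ### Even ranks and nilpotency of `x + tau ω v u`. -/

namespace ExoticRS

open Module

/-- A skew-symmetric matrix of odd size satisfies `det A = -det A`, so it is singular. -/
theorem even_finrank_of_isAlt {W : Type*} [AddCommGroup W] [Module ℂ W] [FiniteDimensional ℂ W]
    (B : LinearMap.BilinForm ℂ W) (hB : B.Nondegenerate) (halt : B.IsAlt) :
    Even (finrank ℂ W) := by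
  let b := finBasis ℂ W
  have hdet := (LinearMap.BilinForm.nondegenerate_iff_det_ne_zero b).1 hB
  set A := LinearMap.BilinForm.toMatrix b B with hA
  have hT : A.transpose = -A := by
    ext i j
    simp only [Matrix.transpose_apply, Matrix.neg_apply, hA, LinearMap.BilinForm.toMatrix_apply]
    exact (LinearMap.IsAlt.neg halt _ _).symm
  have h := Matrix.det_transpose A
  rw [hT, Matrix.det_neg, Fintype.card_fin] at h
  by_contra hodd
  rw [Nat.not_even_iff_odd] at hodd
  rw [hodd.neg_one_pow] at h
  apply hdet
  linear_combination (-1 / 2 : ℂ) * h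

variable {V : Type*} [AddCommGroup V] [Module ℂ V] [FiniteDimensional ℂ V]

/-- The form restricts to a nondegenerate alternating form on any complement of its kernel, and that
complement has the dimension of the range. -/
theorem even_finrank_range_of_isAlt (B : LinearMap.BilinForm ℂ V) (halt : B.IsAlt) :
    Even (finrank ℂ (LinearMap.range B)) := by
  obtain ⟨q, hq⟩ := Submodule.exists_isCompl (LinearMap.ker B)
  have h1 := Submodule.finrank_add_eq_of_isCompl hq
  have h2 := LinearMap.finrank_range_add_finrank_ker B
  have h3 : finrank ℂ (LinearMap.range B) = finrank ℂ q := by omega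
  rw [h3]
  have halt' : (B.restrict q).IsAlt := fun w => halt w
  refine even_finrank_of_isAlt (B.restrict q) ?_ halt'
  have key : ∀ w : q, (∀ w' : q, B w w' = 0) → w = 0 := by
    intro w hw
    have hker : (w : V) ∈ LinearMap.ker B := by
      rw [LinearMap.mem_ker]
      ext z
      obtain ⟨a, ha, c, hc, rfl⟩ := Submodule.mem_sup.1
        (hq.sup_eq_top ▸ Submodule.mem_top : z ∈ LinearMap.ker B ⊔ q)
      rw [map_add, hw ⟨c, hc⟩, ← LinearMap.IsAlt.neg halt a, LinearMap.mem_ker.1 ha]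
      simp
    have := hq.disjoint.le_bot ⟨hker, w.2⟩
    exact Subtype.ext (by simpa using this)
  refine ⟨fun w hw => key w hw, fun w hw => key w fun w' => ?_⟩
  have hw' : B w' w = 0 := hw w'
  rw [← LinearMap.IsAlt.neg halt, hw', neg_zero]

/-- An endomorphism that is self-adjoint for a symplectic form has even rank. -/
theorem even_finrank_range_of_selfAdjoint (ω : LinearMap.BilinForm ℂ V) (hω : ω.Nondegenerate)
    (halt : ω.IsAlt) (s : Module.End ℂ V) (hs : ∀ a b, ω (s a) b = ω a (s b)) :
    Even (finrank ℂ (LinearMap.range s)) := by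
  have hinj : Function.Injective ω := by
    rw [← LinearMap.ker_eq_bot, LinearMap.ker_eq_bot']
    exact fun a ha => hω.1 a fun b => by rw [ha]; rfl
  have h := even_finrank_range_of_isAlt (ω ∘ₗ s) (fun a => by
    have h1 := hs a a
    rw [← LinearMap.IsAlt.neg halt] at h1
    change ω (s a) a = 0
    rw [hs]
    linear_combination (-1 / 2 : ℂ) * h1)
  rw [LinearMap.range_comp] at h
  rwa [← (Submodule.equivMapOfInjective ω hinj (LinearMap.range s)).finrank_eq] at h

-- All roots of the characteristic polynomial vanish, so it is a power of `X`; Cayley–Hamilton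
-- concludes.
open Polynomial in
theorem isNilpotent_of_forall_hasEigenvalue (y : Module.End ℂ V)
    (h : ∀ c, y.HasEigenvalue c → c = 0) : IsNilpotent y := by
  have hroots : y.charpoly.roots = Multiset.replicate (Multiset.card y.charpoly.roots) 0 :=
    Multiset.eq_replicate_of_mem fun c hc =>
      h c ((Module.End.hasEigenvalue_iff_isRoot_charpoly y c).2 (isRoot_of_mem_roots hc))
  have hprod := (IsAlgClosed.splits y.charpoly).eq_prod_roots_of_monic y.charpoly_monic
  rw [hroots, Multiset.map_replicate, Multiset.prod_replicate, C_0, sub_zero] at hprod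
  have haeval := y.aeval_self_charpoly
  rw [hprod, map_pow, aeval_X] at haeval
  exact ⟨_, haeval⟩

theorem isNilpotent_add_tau (ω : LinearMap.BilinForm ℂ V) (hω : ω.Nondegenerate)
    (halt : ω.IsAlt) (hV : Even (finrank ℂ V)) (x : Module.End ℂ V) (hx : IsNilpotent x) (v u : V)
    (hs : ∀ a b, ω ((x + tau ω v u) a) b = ω a ((x + tau ω v u) b)) :
    IsNilpotent (x + tau ω v u) := by
  refine isNilpotent_of_forall_hasEigenvalue _ fun c hc => ?_
  set y := x + tau ω v u with hy
  have heven := even_finrank_range_of_selfAdjoint ω hω halt (y - c • 1) (fun a b => by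
    simp only [LinearMap.sub_apply, LinearMap.smul_apply, Module.End.one_apply, map_sub, map_smul,
      hs])
  have hrank := LinearMap.finrank_range_add_finrank_ker (y - c • 1)
  set K := LinearMap.ker (y - c • 1) with hK
  obtain ⟨w, hw⟩ := hc.exists_hasEigenvector
  have hwK : w ∈ K := by
    rw [hK, LinearMap.mem_ker, LinearMap.sub_apply, hw.apply_eq_smul]
    simp
  have hpos : 0 < finrank ℂ K := by
    rw [finrank_pos_iff_exists_ne_zero]
    exact ⟨⟨w, hwK⟩, fun h => hw.2 (congrArg Subtype.val h)⟩
  have htwo : 2 ≤ finrank ℂ K := by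
    rw [← hrank, Nat.even_add] at hV
    obtain ⟨r, hr⟩ := hV.1 heven
    omega
  -- A linear functional on a space of dimension at least 2 has a nonzero kernel vector; there `tau
  -- ω v u` vanishes and `y` agrees with `x`.
  have hker := LinearMap.finrank_range_add_finrank_ker ((ω u).domRestrict K)
  have hle : finrank ℂ (LinearMap.range ((ω u).domRestrict K)) ≤ 1 :=
    (Submodule.finrank_le _).trans (finrank_self ℂ).le
  have hpos' : 0 < finrank ℂ (LinearMap.ker ((ω u).domRestrict K)) := by omega
  rw [finrank_pos_iff_exists_ne_zero] at hpos'
  obtain ⟨⟨⟨a, haK⟩, ha⟩, hne⟩ := hpos'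
  have hne' : a ≠ 0 := fun h => hne (by ext; exact h)
  have hua : ω u a = 0 := ha
  have hya : y a = c • a := by
    rw [hK, LinearMap.mem_ker, LinearMap.sub_apply, sub_eq_zero] at haK
    simpa using haK
  have hxa : x a = c • a := by
    rw [← hya, hy, LinearMap.add_apply]
    simp [tau, hua]
  have hev : x.HasEigenvalue c :=
    Module.End.hasEigenvalue_of_hasEigenvector ⟨Module.End.mem_eigenspace_iff.2 hxa, hne'⟩
  exact (hev.isNilpotent_of_isNilpotent hx).eq_zero

end ExoticRS

/-! ### Ranks of powers, column lengths and interlacing. -/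

namespace ExoticRS

open Module

/-- The rank of `x ^ k` counts the string basis vectors in the image of `x ^ k`. -/
theorem HasJordanType.finrank_range_pow {V : Type*} [AddCommGroup V] [Module ℂ V]
    [FiniteDimensional ℂ V] {x : Module.End ℂ V} {lam : Ptn} (h : HasJordanType x lam) (k : ℕ) :
    finrank ℂ (LinearMap.range (x ^ k)) =
      {p : Σ i : ℕ, Fin (lam.part i) | (p.2 : ℕ) + k < lam.part p.1}.ncard := by
  obtain ⟨b, h0, h1⟩ := h
  have hfin : Finite (Σ i : ℕ, Fin (lam.part i)) := Module.Finite.finite_basis b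
  have hup : ∀ (k i j : ℕ) (h : j + k < lam.part i),
      (x ^ k) (b ⟨i, ⟨j + k, h⟩⟩) = b ⟨i, ⟨j, lt_of_le_of_lt (Nat.le_add_right j k) h⟩⟩ := by
    intro k
    induction k with
    | zero => intro i j h; simp
    | succ k ih =>
      intro i j h
      rw [pow_succ, Module.End.mul_apply]
      have := h1 i (j + k) h
      rw [show (⟨i, ⟨j + (k + 1), h⟩⟩ : Σ i : ℕ, Fin (lam.part i)) = ⟨i, ⟨j + k + 1, h⟩⟩ from rfl,
        this, ih]
  have hdown : ∀ (k i j : ℕ) (h : j < lam.part i), j < k → (x ^ k) (b ⟨i, ⟨j, h⟩⟩) = 0 := by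
    intro k i j h hk
    obtain ⟨m, rfl⟩ := Nat.exists_eq_add_of_le' (Nat.succ_le_of_lt hk)
    have h2 := hup j i 0 (by omega)
    simp only [Nat.zero_add] at h2
    rw [Nat.succ_eq_add_one, pow_add, pow_succ', Module.End.mul_apply, Module.End.mul_apply, h2,
      h0, map_zero]
  set S := {p : Σ i : ℕ, Fin (lam.part i) | (p.2 : ℕ) + k < lam.part p.1} with hS
  have hrange : LinearMap.range (x ^ k) = Submodule.span ℂ (Set.range fun p : S => b p) := by
    apply le_antisymm
    · rw [LinearMap.range_eq_map, ← b.span_eq, Submodule.map_span, Submodule.span_le]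
      rintro _ ⟨_, ⟨⟨i, ⟨j, hj⟩⟩, rfl⟩, rfl⟩
      by_cases hjk : j < k
      · rw [hdown k i j hj hjk]
        exact Submodule.zero_mem _
      · obtain ⟨m, rfl⟩ := Nat.exists_eq_add_of_le' (not_lt.1 hjk)
        rw [hup]
        exact Submodule.subset_span ⟨⟨⟨i, ⟨m, _⟩⟩, hj⟩, rfl⟩
    · rw [Submodule.span_le]
      rintro _ ⟨⟨⟨i, ⟨j, hj⟩⟩, hp⟩, rfl⟩
      exact ⟨_, hup k i j hp⟩
  have : Fintype S := Fintype.ofFinite S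
  rw [hrange, show (fun p : S => b p) = b ∘ Subtype.val from rfl,
    finrank_span_eq_card (b.linearIndependent.comp _ Subtype.val_injective),
    ← Nat.card_eq_fintype_card, Nat.card_coe_set_eq]

/-- The `k`-th column length of a partition. -/
noncomputable def Ptn.col (lam : Ptn) (k : ℕ) : ℕ := {i | k < lam.part i}.ncard

theorem Ptn.lt_col_iff (lam : Ptn) (k i : ℕ) : i < lam.col k ↔ k < lam.part i := by
  have hfin : {i | k < lam.part i}.Finite :=
    lam.finite_support.subset fun i (hi : k < lam.part i) => by
      simp only [Function.mem_support]; omega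
  constructor
  · intro h
    by_contra hk
    have hsub : {i | k < lam.part i} ⊆ ↑(Finset.range i) := by
      intro j (hj : k < lam.part j)
      simp only [Finset.coe_range, Set.mem_Iio]
      by_contra hij
      have := lam.antitone_part (not_lt.1 hij)
      omega
    have := Set.ncard_le_ncard hsub (Finset.finite_toSet _)
    rw [Set.ncard_coe_finset, Finset.card_range] at this
    exact absurd h (not_lt.2 this)
  · intro h
    have hsub : (↑(Finset.range (i + 1)) : Set ℕ) ⊆ {i | k < lam.part i} := by
      intro j hj
      simp only [Finset.coe_range, Set.mem_Iio] at hj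
      have := lam.antitone_part (Nat.le_of_lt_succ hj)
      exact lt_of_lt_of_le h this
    have := Set.ncard_le_ncard hsub hfin
    rw [Set.ncard_coe_finset, Finset.card_range] at this
    exact this

variable {V : Type*} [AddCommGroup V] [Module ℂ V] [FiniteDimensional ℂ V]

/-- Passing from `x ^ k` to `x ^ (k + 1)` loses one basis vector from the image for each string of
length greater than `k`. -/
theorem HasJordanType.finrank_range_pow_succ {x : Module.End ℂ V} {lam : Ptn}
    (h : HasJordanType x lam) (k : ℕ) :
    finrank ℂ (LinearMap.range (x ^ k)) =
      finrank ℂ (LinearMap.range (x ^ (k + 1))) + lam.col k := by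
  rw [h.finrank_range_pow, h.finrank_range_pow]
  obtain ⟨b, -, -⟩ := h
  have hfin : Finite (Σ i : ℕ, Fin (lam.part i)) := Module.Finite.finite_basis b
  have hT : {p : Σ i : ℕ, Fin (lam.part i) | (p.2 : ℕ) + k + 1 = lam.part p.1}.ncard
      = lam.col k := by
    rw [Ptn.col, ← Set.InjOn.ncard_image (f := Sigma.fst)]
    · congr 1
      ext i
      constructor
      · rintro ⟨⟨i, j⟩, hp, rfl⟩
        simp only [Set.mem_ofPred_eq] at hp ⊢
        omega
      · intro hi
        simp only [Set.mem_ofPred_eq] at hi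
        exact ⟨⟨i, ⟨lam.part i - k - 1, by omega⟩⟩, by simp only [Set.mem_ofPred_eq]; omega, rfl⟩
    · rintro ⟨i, ⟨j, hj⟩⟩ hp ⟨i', ⟨j', hj'⟩⟩ hp' (rfl : i = i')
      simp only [Set.mem_ofPred_eq] at hp hp'
      obtain rfl : j = j' := by omega
      rfl
  rw [← hT, ← Set.ncard_union_eq]
  · congr 1
    ext p
    simp only [Set.mem_ofPred_eq, Set.mem_union]
    omega
  · rw [Set.disjoint_left]
    intro p hp hp'
    simp only [Set.mem_ofPred_eq] at hp hp'
    omega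

theorem Ptn.exists_bound (lam : Ptn) : ∃ N, ∀ i, N ≤ i → lam.part i = 0 := by
  obtain ⟨N, hN⟩ := lam.finite_support.bddAbove
  refine ⟨N + 1, fun i hi => ?_⟩
  by_contra h
  have : i ≤ N := hN h
  omega

theorem Ptn.size_eq_sum (lam : Ptn) {N : ℕ} (hN : ∀ i, N ≤ i → lam.part i = 0) :
    lam.size = ∑ i ∈ Finset.range N, lam.part i := by
  refine finsum_eq_sum_of_support_subset _ fun i hi => ?_
  by_contra h
  simp only [Finset.coe_range, Set.mem_Iio, not_lt] at h
  exact hi (hN i h)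

theorem HasJordanType.finrank_eq_size {V : Type*} [AddCommGroup V] [Module ℂ V]
    {x : Module.End ℂ V} {lam : Ptn}
    (h : HasJordanType x lam) : finrank ℂ V = lam.size := by
  obtain ⟨b, -, -⟩ := h
  obtain ⟨N, hN⟩ := lam.exists_bound
  rw [finrank_eq_nat_card_basis b, lam.size_eq_sum hN, ← Set.ncard_univ]
  have : (Set.univ : Set (Σ i : ℕ, Fin (lam.part i))) =
      ↑((Finset.range N).sigma fun i => (Finset.univ : Finset (Fin (lam.part i)))) := by
    ext ⟨i, j⟩
    simp only [Set.mem_univ, Finset.coe_sigma, Set.mem_sigma_iff, Finset.coe_range, Set.mem_Iio,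
      Finset.coe_univ, and_true, true_iff]
    by_contra hi
    have := hN i (not_lt.1 hi)
    have := j.2
    omega
  rw [this, Set.ncard_coe_finset, Finset.card_sigma]
  simp

theorem finrank_map_add_finrank_inf_ker {W : Type*} [AddCommGroup W] [Module ℂ W]
    (f : V →ₗ[ℂ] W) (P : Submodule ℂ V) :
    finrank ℂ (P.map f) + finrank ℂ (P ⊓ LinearMap.ker f : Submodule ℂ V) = finrank ℂ P := by
  have h := LinearMap.finrank_range_add_finrank_ker (f.domRestrict P)
  rw [LinearMap.range_domRestrict, LinearMap.ker_domRestrict] at h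
  rw [← h, ← Submodule.map_comap_subtype, Submodule.finrank_map_subtype_eq]

/-- The image of `ℂ[x]v` under `x` together with `v` spans `ℂ[x]v`, so `x` drops its dimension by at
most one. -/
theorem finrank_cyclicSubspace_inf_ker_le_one (x : Module.End ℂ V) (v : V) :
    finrank ℂ (cyclicSubspace x v ⊓ LinearMap.ker x : Submodule ℂ V) ≤ 1 := by
  have h := finrank_map_add_finrank_inf_ker x (cyclicSubspace x v)
  have hle : cyclicSubspace x v ≤ (cyclicSubspace x v).map x ⊔ Submodule.span ℂ {v} := by
    refine Submodule.span_le.2 ?_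
    rintro _ ⟨i, rfl⟩
    cases i with
    | zero =>
      exact Submodule.mem_sup_right (by simp)
    | succ i =>
      refine Submodule.mem_sup_left ⟨(x ^ i) v, Submodule.subset_span ⟨i, rfl⟩, ?_⟩
      simp [pow_succ']
  have h1 := Submodule.finrank_mono hle
  have h2 := Submodule.finrank_add_le_finrank_add_finrank
    ((cyclicSubspace x v).map x) (Submodule.span ℂ {v})
  have h3 : finrank ℂ (Submodule.span ℂ {v}) ≤ 1 :=
    (finrank_span_le_card {v}).trans (by simp)
  omega

theorem finrank_range_inducedQuotient_pow (x : Module.End ℂ V) (v : V) (k : ℕ) :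
    finrank ℂ (LinearMap.range (inducedQuotient x v ^ k)) +
      finrank ℂ (LinearMap.range (x ^ k) ⊓ cyclicSubspace x v : Submodule ℂ V) =
      finrank ℂ (LinearMap.range (x ^ k)) := by
  have h := finrank_map_add_finrank_inf_ker (cyclicSubspace x v).mkQ (LinearMap.range (x ^ k))
  rw [Submodule.ker_mkQ] at h
  rw [← h, inducedQuotient, ← Submodule.mapQ_pow, Submodule.range_mapQ]

/-- The Jordan types of `x` and of the map induced on the quotient by a cyclic subspace
interlace. -/
theorem interlace {x : Module.End ℂ V} {v : V} {lam kap : Ptn}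
    (hlam : HasJordanType x lam) (hkap : HasJordanType (inducedQuotient x v) kap) (i : ℕ) :
    kap.part i ≤ lam.part i ∧ lam.part (i + 1) ≤ kap.part i := by
  -- The difference of the column lengths is `dim U - dim U'`. It is at most one because `x` maps
  -- `U` into `U'` with kernel inside `ℂ[x]v ∩ ker x`.
  have hcol : ∀ k, kap.col k ≤ lam.col k ∧ lam.col k ≤ kap.col k + 1 := by
    intro k
    have h1 := hlam.finrank_range_pow_succ k
    have h2 := hkap.finrank_range_pow_succ k
    have h3 := finrank_range_inducedQuotient_pow x v k
    have h4 := finrank_range_inducedQuotient_pow x v (k + 1)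
    set U := LinearMap.range (x ^ k) ⊓ cyclicSubspace x v
    set U' := LinearMap.range (x ^ (k + 1)) ⊓ cyclicSubspace x v
    have h5 : U' ≤ U := by
      refine inf_le_inf_right _ ?_
      rw [pow_succ]
      exact LinearMap.range_comp_le_range _ _
    have h6 := finrank_map_add_finrank_inf_ker x U
    have h7 : U.map x ≤ U' := by
      rintro _ ⟨w, ⟨⟨z, rfl⟩, hw⟩, rfl⟩
      exact ⟨⟨z, by rw [pow_succ', Module.End.mul_apply]⟩, cyclicSubspace_le_comap x v hw⟩
    have h8 : U ⊓ LinearMap.ker x ≤ cyclicSubspace x v ⊓ LinearMap.ker x :=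
      inf_le_inf_right _ inf_le_right
    have h9 := finrank_cyclicSubspace_inf_ker_le_one x v
    have h10 := Submodule.finrank_mono h5
    have h11 := Submodule.finrank_mono h7
    have h12 := Submodule.finrank_mono h8
    omega
  constructor
  · by_contra h
    have h1 := (kap.lt_col_iff (lam.part i) i).2 (not_le.1 h)
    exact lt_irrefl _ ((lam.lt_col_iff _ _).1 (h1.trans_le (hcol _).1))
  · by_contra h
    have h1 := (lam.lt_col_iff (kap.part i) (i + 1)).2 (not_le.1 h)
    have h2 := (hcol (kap.part i)).2
    exact lt_irrefl _ ((kap.lt_col_iff (kap.part i) i).1 (by omega))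

/-- If all powers of `y` have even rank, the parts of its Jordan type come in equal pairs. -/
theorem HasJordanType.part_two_mul {y : Module.End ℂ V} {lam : Ptn} (h : HasJordanType y lam)
    (heven : ∀ k, Even (finrank ℂ (LinearMap.range (y ^ k)))) (i : ℕ) :
    lam.part (2 * i + 1) = lam.part (2 * i) := by
  refine le_antisymm (lam.antitone_part (Nat.le_succ _)) ?_
  by_contra hlt
  -- A strict drop here would make this column have length exactly `2 * i + 1`, yet column lengths
  -- are differences of even ranks.
  have h1 := (lam.lt_col_iff (lam.part (2 * i + 1)) (2 * i)).2 (not_le.1 hlt)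
  have h2 := h.finrank_range_pow_succ (lam.part (2 * i + 1))
  obtain ⟨r, hr⟩ := heven (lam.part (2 * i + 1))
  obtain ⟨r', hr'⟩ := heven (lam.part (2 * i + 1) + 1)
  exact lt_irrefl _ ((lam.lt_col_iff (lam.part (2 * i + 1)) (2 * i + 1)).1 (by omega))

end ExoticRS

/-! ### Combinatorics of bipartitions. -/

namespace ExoticRS

open Module

theorem Ptn.size_add (mu nu : Ptn) : (mu.add nu).size = mu.size + nu.size :=
  finsum_add_distrib mu.finite_support nu.finite_support

theorem Ptn.size_eq_part_zero_add_tail (lam : Ptn) : lam.size = lam.part 0 + lam.tail.size := by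
  obtain ⟨N, hN⟩ := lam.exists_bound
  rw [lam.size_eq_sum (N := N + 1) (fun i hi => hN i (by omega)),
    lam.tail.size_eq_sum (N := N) (fun i hi => hN (i + 1) (by omega)), Finset.sum_range_succ',
    add_comm]
  rfl

theorem Ptn.size_dup (lam : Ptn) : lam.dup.size = 2 * lam.size := by
  obtain ⟨N, hN⟩ := lam.exists_bound
  rw [lam.size_eq_sum hN, lam.dup.size_eq_sum (N := 2 * N) (fun i hi => hN (i / 2) (by omega))]
  clear hN
  induction N with
  | zero => simp
  | succ N ih =>
    rw [Nat.mul_succ, Finset.sum_range_succ, Finset.sum_range_succ, Finset.sum_range_succ, ih,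
      Nat.mul_add]
    simp only [Ptn.dup]
    rw [show 2 * N / 2 = N by omega, show (2 * N + 1) / 2 = N by omega]
    ring

theorem Ptn.altSum_eq_partialAltSum (lam : Ptn) {N : ℕ} (hN : ∀ i, N ≤ i → lam.part i = 0) :
    lam.altSum = lam.partialAltSum N := by
  refine finsum_eq_sum_of_support_subset _ fun i hi => ?_
  by_contra h
  simp only [Finset.coe_range, Set.mem_Iio, not_lt] at h
  exact hi (by simp [hN i h])

theorem Ptn.partialAltSum_two_mul_add_one (lam : Ptn) (k : ℕ) :
    lam.partialAltSum (2 * k + 1) = lam.partialAltSum (2 * k) + lam.part (2 * k) := by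
  rw [partialAltSum, Finset.sum_range_succ, (even_two_mul k).neg_one_pow, one_mul]
  rfl

theorem Ptn.partialAltSum_two_mul_add_two (lam : Ptn) (k : ℕ) :
    lam.partialAltSum (2 * k + 2) = lam.partialAltSum (2 * k + 1) - lam.part (2 * k + 1) := by
  rw [partialAltSum, Finset.sum_range_succ, (odd_two_mul_add_one k).neg_one_pow, neg_one_mul,
    ← sub_eq_add_neg]
  rfl

/-- Interlacing partitions `λ`, `κ` come from a bipartition `(μ; ν)` with
`λ = μ + ν` and `κ = (μ₂ + ν₁, μ₃ + ν₂, …)`. -/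
theorem exists_bipartition_of_interlace (lam kap : Ptn)
    (h : ∀ i, kap.part i ≤ lam.part i ∧ lam.part (i + 1) ≤ kap.part i) :
    ∃ mu nu : Ptn, mu.add nu = lam ∧ mu.tail.add nu = kap := by
  obtain ⟨B, hB⟩ := lam.exists_bound
  have hB' : ∀ i, B ≤ i → kap.part i = 0 := fun i hi => by
    have := (h i).1
    have := hB i hi
    omega
  -- The required parts satisfy `μ_i - μ_{i+1} = λ_i - κ_i` and `ν_i - ν_{i+1} = κ_i - λ_{i+1}`, so
  -- both are tail sums. Interlacing makes the truncated subtractions exact.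
  have main : ∀ f : ℕ → ℕ, (∀ i, B ≤ i → f i = 0) →
      ∃ M : Ptn, (∀ i, M.part i = f i + M.part (i + 1)) ∧ ∀ i, B ≤ i → M.part i = 0 := by
    intro f hf
    let m : ℕ → ℕ := fun i => ∑ j ∈ Finset.Ico i B, f j
    have hm0 : ∀ i, B ≤ i → m i = 0 := fun i hi => by simp [m, hi]
    have hm : ∀ i, m i = f i + m (i + 1) := by
      intro i
      by_cases hi : i < B
      · exact Finset.sum_eq_sum_Ico_succ_bot hi f
      · rw [hm0 i (by omega), hm0 (i + 1) (by omega), hf i (by omega)]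
    exact ⟨⟨m, antitone_nat_of_succ_le fun i => by have := hm i; omega,
      (Set.finite_Iio B).subset fun i hi => by
        by_contra hi'
        exact hi (hm0 i (not_lt.1 hi'))⟩, hm, hm0⟩
  obtain ⟨mu, hmu, hmu0⟩ := main (fun i => lam.part i - kap.part i) fun i hi => by
    simp only [hB i hi, hB' i hi]
  obtain ⟨nu, hnu, hnu0⟩ := main (fun i => kap.part i - lam.part (i + 1)) fun i hi => by
    simp only [hB (i + 1) (by omega), hB' i hi]
  -- Descending induction on `i` from the bound `B`, with `m` measuring the distance.
  have hadd : ∀ m i, B ≤ i + m → mu.part i + nu.part i = lam.part i := by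
    intro m
    induction m with
    | zero => intro i hi; rw [hmu0 i hi, hnu0 i hi, hB i hi]
    | succ m ih =>
      intro i hi
      have h1 := ih (i + 1) (by omega)
      have h2 := hmu i
      have h3 := hnu i
      have h4 := h i
      omega
  have hadd' : ∀ i, mu.part i + nu.part i = lam.part i := fun i => hadd B i (by omega)
  refine ⟨mu, nu, Ptn.ext (funext hadd'), Ptn.ext (funext fun i => ?_)⟩
  have h1 := hadd' (i + 1)
  have h2 := hadd' i
  have h3 := hmu i
  have h4 := h i
  change mu.part (i + 1) + nu.part i = kap.part i
  omega

/-- A partition whose parts come in equal pairs is a duplex partition. -/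
theorem Ptn.exists_dup_eq (lam : Ptn) (h : ∀ i, lam.part (2 * i + 1) = lam.part (2 * i)) :
    ∃ mu : Ptn, mu.dup = lam := by
  refine ⟨⟨fun i => lam.part (2 * i), fun i j hij => lam.antitone_part (by omega), ?_⟩, ?_⟩
  · exact lam.finite_support.preimage (f := fun i => 2 * i)
      (fun i _ j _ (hij : 2 * i = 2 * j) => by omega)
  · ext i
    change lam.part (2 * (i / 2)) = lam.part i
    rcases Nat.even_or_odd' i with ⟨k, rfl | rfl⟩
    · congr 1
      omega
    · rw [h]
      congr 1
      omega

theorem Ptn.part_dup_two_mul (lam : Ptn) (k : ℕ) : lam.dup.part (2 * k) = lam.part k :=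
  congrArg lam.part (by omega)

theorem Ptn.part_dup_two_mul_add_one (lam : Ptn) (k : ℕ) :
    lam.dup.part (2 * k + 1) = lam.part k :=
  congrArg lam.part (by omega)

/-- The first part fixes `mu'.part 0`. The even-indexed entries of the common quotient type then
give `nu'.part k` from `mu'.part k`, and the odd-indexed ones give `mu'.part (k + 1)` from `nu'.part
k`. -/
theorem duplex_part_formula {mu nu mu' nu' : Ptn} (h0 : mu.part 0 = mu'.part 0)
    (h : mu.tail.add nu = mu'.dup.tail.add nu'.dup) (k : ℕ) :
    (mu'.part k : ℤ) = mu.partialAltSum (2 * k + 1) - nu.partialAltSum (2 * k) ∧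
      (nu'.part k : ℤ) = nu.partialAltSum (2 * k + 1) - mu.partialAltSum (2 * k + 2) := by
  have hodd : ∀ k, mu.part (2 * k + 1) + nu.part (2 * k) = mu'.part k + nu'.part k := by
    intro k
    have : mu.part (2 * k + 1) + nu.part (2 * k) =
      mu'.dup.part (2 * k + 1) + nu'.dup.part (2 * k) := congrArg (fun l => l.part (2 * k)) h
    rwa [Ptn.part_dup_two_mul, Ptn.part_dup_two_mul_add_one] at this
  have heven : ∀ k, mu.part (2 * (k + 1)) + nu.part (2 * k + 1) =
      mu'.part (k + 1) + nu'.part k := by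
    intro k
    have : mu.part (2 * (k + 1)) + nu.part (2 * k + 1) =
      mu'.dup.part (2 * (k + 1)) + nu'.dup.part (2 * k + 1) :=
      congrArg (fun l => l.part (2 * k + 1)) h
    rwa [Ptn.part_dup_two_mul, Ptn.part_dup_two_mul_add_one] at this
  have hstep : ∀ k, (mu'.part k : ℤ) = mu.partialAltSum (2 * k + 1) - nu.partialAltSum (2 * k) →
      (nu'.part k : ℤ) = nu.partialAltSum (2 * k + 1) - mu.partialAltSum (2 * k + 2) := by
    intro k hk
    have h1 := hodd k
    rw [Ptn.partialAltSum_two_mul_add_two, Ptn.partialAltSum_two_mul_add_one nu]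
    omega
  have hmu : ∀ k, (mu'.part k : ℤ) =
      mu.partialAltSum (2 * k + 1) - nu.partialAltSum (2 * k) := by
    intro k
    induction k with
    | zero => simp [Ptn.partialAltSum, h0]
    | succ k ih =>
      have h1 := heven k
      have h2 := hstep k ih
      rw [Ptn.partialAltSum_two_mul_add_one, Nat.mul_succ, Ptn.partialAltSum_two_mul_add_two nu]
      rw [Nat.mul_succ] at h1
      omega
  exact ⟨hmu k, hstep k (hmu k)⟩

theorem altSum_eq_of_part_formula {mu nu nu' : Ptn}
    (h : ∀ k : ℕ, (nu'.part k : ℤ) =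
      nu.partialAltSum (2 * k + 1) - mu.partialAltSum (2 * k + 2)) :
    mu.altSum = nu.altSum := by
  obtain ⟨A, hA⟩ := mu.exists_bound
  obtain ⟨B, hB⟩ := nu.exists_bound
  obtain ⟨C, hC⟩ := nu'.exists_bound
  -- At this index all three partitions have ended, so the partial sums are full alternating sums
  -- and their difference is zero.
  have h1 := h (A + B + C)
  rw [hC _ (by omega)] at h1
  rw [mu.altSum_eq_partialAltSum (N := 2 * (A + B + C) + 2) (fun i hi => hA i (by omega)),
    nu.altSum_eq_partialAltSum (N := 2 * (A + B + C) + 1) (fun i hi => hB i (by omega))]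
  push_cast at h1
  omega

/-! ### Orbits of `(v, x)` under perturbation of `x` along `v`. -/

section

variable {V : Type*} [AddCommGroup V] [Module ℂ V]

theorem HasJordanType.mapQ_congr {W W' : Submodule ℂ V} {f g : Module.End ℂ V}
    (hW : W = W') (hfg : ∀ a, f a - g a ∈ W) (hf : W ≤ W.comap f) (hg : W' ≤ W'.comap g)
    {kap : Ptn} (h : HasJordanType (W.mapQ W f hf) kap) : HasJordanType (W'.mapQ W' g hg) kap := by
  subst hW
  have : W.mapQ W f hf = W.mapQ W g hg := by
    ext a
    simp only [LinearMap.comp_apply, Submodule.mkQ_apply, Submodule.mapQ_apply]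
    exact (Submodule.Quotient.eq W).2 (hfg a)
  rwa [← this]

/-- The subspace `ℂ[x]v` contains `v`, so it stays stable when `x` is changed by multiples of `v`.
-/
theorem cyclicSubspace_le_of_sub_mem {x y : Module.End ℂ V} {v : V}
    (h : ∀ a, y a - x a ∈ Submodule.span ℂ {v}) : cyclicSubspace y v ≤ cyclicSubspace x v := by
  have hv : v ∈ cyclicSubspace x v := Submodule.subset_span ⟨0, by simp⟩
  refine Submodule.span_le.2 ?_
  rintro _ ⟨i, rfl⟩
  induction i with
  | zero => simpa using hv
  | succ i ih =>
    have h1 := (Submodule.span_singleton_le_iff_mem v (cyclicSubspace x v)).2 hv (h ((y ^ i) v))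
    have h2 := (cyclicSubspace x v).add_mem h1 (cyclicSubspace_le_comap x v ih)
    simpa [pow_succ'] using h2

variable [FiniteDimensional ℂ V]

/-- Every point of the enhanced nilpotent cone lies in an orbit `O_{μ;ν}`. -/
theorem exists_mem_enhancedOrbit (v : V) (x : Module.End ℂ V) (hx : IsNilpotent x) :
    ∃ mu nu : Ptn, (mu, nu) ∈ bipartitions (finrank ℂ V) ∧ (v, x) ∈ enhancedOrbit V mu nu := by
  obtain ⟨lam, hlam⟩ := exists_hasJordanType x hx
  obtain ⟨N, hN⟩ := hx
  have hq : IsNilpotent (inducedQuotient x v) := by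
    refine ⟨N, ?_⟩
    rw [inducedQuotient, ← Submodule.mapQ_pow]
    ext a
    simp [hN]
  obtain ⟨kap, hkap⟩ := exists_hasJordanType _ hq
  obtain ⟨mu, nu, rfl, rfl⟩ := exists_bipartition_of_interlace lam kap (interlace hlam hkap)
  exact ⟨mu, nu, by rw [hlam.finrank_eq_size, Ptn.size_add]; rfl, ⟨N, hN⟩, hlam, hkap⟩

/-- For a point of an enhanced orbit, `μ₁` is the dimension of the cyclic subspace. -/
theorem part_zero_eq_finrank_cyclicSubspace {v : V} {x : Module.End ℂ V} {mu nu : Ptn}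
    (h : (v, x) ∈ enhancedOrbit V mu nu) : mu.part 0 = finrank ℂ (cyclicSubspace x v) := by
  have h1 : finrank ℂ V = _ := h.2.1.finrank_eq_size
  have h2 : finrank ℂ (V ⧸ cyclicSubspace x v) = _ := h.2.2.finrank_eq_size
  -- The dimensions of `V` and of the quotient are `|μ| + |ν|` and `|μ| - μ₁ + |ν|`; they differ by
  -- `μ₁`.
  have h3 := Submodule.finrank_quotient_add_finrank (cyclicSubspace x v)
  rw [Ptn.size_add] at h1 h2
  have h4 := mu.size_eq_part_zero_add_tail
  omega

/-- A self-adjoint point of the enhanced cone lies in the enhanced orbit of a duplex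
bipartition, with prescribed Jordan type on the quotient. -/
theorem exists_mem_enhancedOrbit_dup (v : V) (y : Module.End ℂ V) (hy : IsNilpotent y)
    (heven : ∀ k, Even (finrank ℂ (LinearMap.range (y ^ k)))) {kap : Ptn}
    (hkap : HasJordanType (inducedQuotient y v) kap) :
    ∃ mu nu : Ptn, mu.dup.tail.add nu.dup = kap ∧ (v, y) ∈ enhancedOrbit V mu.dup nu.dup := by
  obtain ⟨lam, hlam⟩ := exists_hasJordanType y hy
  have hpair := hlam.part_two_mul heven
  have hint := interlace hlam hkap
  obtain ⟨M, N, rfl, rfl⟩ := exists_bipartition_of_interlace lam kap hint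
  -- Both `M` and `N` are weakly decreasing, so equality of consecutive sums forces equality in
  -- each.
  have hM : ∀ i, M.part (2 * i + 1) = M.part (2 * i) ∧ N.part (2 * i + 1) = N.part (2 * i) := by
    intro i
    have h1 : M.part (2 * i + 1) + N.part (2 * i + 1) = M.part (2 * i) + N.part (2 * i) := hpair i
    have h2 := M.antitone_part (Nat.le_succ (2 * i))
    have h3 := N.antitone_part (Nat.le_succ (2 * i))
    simp only [Nat.succ_eq_add_one] at h2 h3
    omega
  obtain ⟨mu, rfl⟩ := M.exists_dup_eq fun i => (hM i).1
  obtain ⟨nu, rfl⟩ := N.exists_dup_eq fun i => (hM i).2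
  exact ⟨mu, nu, rfl, hy, hlam, hkap⟩

end

end ExoticRS

/-! ### The main theorem. -/

theorem mainTheorem5 (n : ℕ) (V : Type*) [AddCommGroup V] [Module ℂ V]
    [FiniteDimensional ℂ V] (hdim : Module.finrank ℂ V = 2 * n)
    (ω : LinearMap.BilinForm ℂ V) (hω : ω.Nondegenerate) (halt : ω.IsAlt)
    (v u : V) (x : Module.End ℂ V) (hZ : (v, u, x) ∈ ExoticRS.Z ω hω) :
    (∃ mu nu : ExoticRS.Ptn, (mu, nu) ∈ ExoticRS.balancedBipartitions (2 * n) ∧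
      (v, x) ∈ ExoticRS.enhancedOrbit V mu nu) ∧
    ∀ mu nu : ExoticRS.Ptn, (mu, nu) ∈ ExoticRS.bipartitions (2 * n) →
      (v, x) ∈ ExoticRS.enhancedOrbit V mu nu →
      (mu, nu) ∈ ExoticRS.balancedBipartitions (2 * n) ∧
      ∃ mu' nu' : ExoticRS.Ptn, (mu', nu') ∈ ExoticRS.bipartitions n ∧
        (∀ k : ℕ,
          (mu'.part k : ℤ) = mu.partialAltSum (2 * k + 1) - nu.partialAltSum (2 * k) ∧
          (nu'.part k : ℤ) = nu.partialAltSum (2 * k + 1) - mu.partialAltSum (2 * k + 2)) ∧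
        (v, x + ExoticRS.tau ω v u) ∈ ExoticRS.exoticOrbit ω hω mu' nu' := by
  open ExoticRS in
  obtain ⟨hx, hadj⟩ := hZ
  change IsNilpotent x at hx
  change adjoint ω hω x - x = tau ω v u + tau ω u v at hadj
  have hself : ∀ a b, ω ((x + tau ω v u) a) b = ω a ((x + tau ω v u) b) := by
    intro a b
    have h1 : adjoint ω hω x b = x b + (ω u b • v + ω v b • u) := by
      have := congrArg (fun f : Module.End ℂ V => f b) hadj
      simp only [LinearMap.sub_apply, LinearMap.add_apply, tau, LinearMap.smulRight_apply] at this
      rw [← this]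
      abel
    simp only [LinearMap.add_apply, map_add, tau, LinearMap.smulRight_apply, map_smul,
      LinearMap.smul_apply, adjoint_apply ω hω x, h1, smul_eq_mul]
    rw [← LinearMap.IsAlt.neg halt a u]
    ring
  have hnil : IsNilpotent (x + tau ω v u) :=
    isNilpotent_add_tau ω hω halt (hdim ▸ even_two_mul n) x hx v u hself
  have heven : ∀ k, Even (Module.finrank ℂ (LinearMap.range ((x + tau ω v u) ^ k))) := by
    intro k
    refine even_finrank_range_of_selfAdjoint ω hω halt _ ?_
    induction k with
    | zero => intro a b; rfl
    | succ k ih =>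
      intro a b
      rw [pow_succ, Module.End.mul_apply, ih, hself, ← Module.End.mul_apply, ← pow_succ',
        ← pow_succ]
  have hsub : ∀ a, (x + tau ω v u) a - x a ∈ Submodule.span ℂ {v} := fun a => by
    rw [LinearMap.add_apply, add_sub_cancel_left]
    exact Submodule.smul_mem _ _ (Submodule.mem_span_singleton_self v)
  have hsub' : ∀ a, x a - (x + tau ω v u) a ∈ Submodule.span ℂ {v} := fun a => by
    rw [← neg_sub]
    exact Submodule.neg_mem _ (hsub a)
  have hcyc : cyclicSubspace x v = cyclicSubspace (x + tau ω v u) v :=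
    le_antisymm (cyclicSubspace_le_of_sub_mem hsub') (cyclicSubspace_le_of_sub_mem hsub)
  have hspan : Submodule.span ℂ {v} ≤ cyclicSubspace x v :=
    (Submodule.span_singleton_le_iff_mem v _).2 (Submodule.subset_span ⟨0, by simp⟩)
  have main : ∀ mu nu : Ptn, (mu, nu) ∈ bipartitions (2 * n) → (v, x) ∈ enhancedOrbit V mu nu →
      (mu, nu) ∈ balancedBipartitions (2 * n) ∧
      ∃ mu' nu' : Ptn, (mu', nu') ∈ bipartitions n ∧
        (∀ k : ℕ,
          (mu'.part k : ℤ) = mu.partialAltSum (2 * k + 1) - nu.partialAltSum (2 * k) ∧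
          (nu'.part k : ℤ) = nu.partialAltSum (2 * k + 1) - mu.partialAltSum (2 * k + 2)) ∧
        (v, x + tau ω v u) ∈ exoticOrbit ω hω mu' nu' := by
    intro mu nu hsize horb
    -- The quotient type of `x` is transferred to `y`, so the duplex bipartition obtained next
    -- shares it with `(mu; nu)`.
    have hkap : HasJordanType (inducedQuotient (x + tau ω v u) v) (mu.tail.add nu) :=
      HasJordanType.mapQ_congr hcyc (fun a => hspan (hsub' a)) (cyclicSubspace_le_comap x v)
        (cyclicSubspace_le_comap (x + tau ω v u) v) horb.2.2
    obtain ⟨mu', nu', hq, horb'⟩ := exists_mem_enhancedOrbit_dup v _ hnil heven hkap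
    have h0 : mu.part 0 = mu'.part 0 := by
      rw [part_zero_eq_finrank_cyclicSubspace horb, hcyc,
        ← part_zero_eq_finrank_cyclicSubspace horb']
      rfl
    have hform := duplex_part_formula h0 hq.symm
    refine ⟨⟨hsize, altSum_eq_of_part_formula fun k => (hform k).2⟩, mu', nu', ?_, hform,
      ⟨hnil, eq_adjoint ω hω _ _ hself⟩, horb'⟩
    have h1 := horb'.2.1.finrank_eq_size
    rw [Ptn.size_add, Ptn.size_dup, Ptn.size_dup, hdim] at h1
    change mu'.size + nu'.size = n
    omega
  refine ⟨?_, main⟩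
  obtain ⟨mu, nu, hsize, horb⟩ := exists_mem_enhancedOrbit v x hx
  rw [hdim] at hsize
  exact ⟨mu, nu, (main mu nu hsize horb).1, horb⟩
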